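/- **Setting.** Let $n\ge 1$ and let $\varepsilon=(\varepsilon_1,\dots,\varepsilon_n)$ be a vector of positive reals with $\varepsilon_1\le\dots\le\varepsilon_n$. Write $x_1^k=(x_1,\dots,x_k)$ (with $\|x_1^0\|_1=0$) and $a\wedge b=\min\{a,b\}$. Let $\mathcal X=\mathcal Y=[-\tfrac12,\tfrac12]$. A randomized algorithm (Markov kernel) $M$ from $\mathcal X^n$ to $\mathcal Y$ is called $\varepsilon$-DP if for every $i\in\{1,\dots,n\}$, all $x,x'\in\mathcal X^n$ that differ only in the $i$-th component, and every measurable $S\subseteq\mathcal Y$, $$\Pr[M(x)\in S]\le e^{\varepsilon_i}\Pr[M(x')\in S].$$ The minimax error is $$L(\varepsilon)=\inf_{M\ \varepsilon\text{-DP}}\ \sup_{P}\ \mathbb E_{X\sim P^n,\,M}\big[(M(X)-\mu_P)^2\big],$$ where $P$ ranges over all probability distributions on $[-\tfrac12,\tfrac12]$ and $\mu_P$ is the mean of $P$. Define $$f(x_1^k)=\frac{\|x_1^k\|_2^2+8}{4\|x_1^k\|_1^2},\qquad H(\varepsilon_1^n)=\max_{0\le i\le n}\frac{1}{\|\varepsilon_1^i\|_1^2+n-i},$$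 and define $r_1,\dots,r_n$ by $r_1=\varepsilon_1$ and $$r_{k+1}=\min\Big\{\varepsilon_{k+1},\ \frac{\|r_1^k\|_2^2+8}{\|r_1^k\|_1}\Big\}\qquad(1\le k<n).$$ **Theorem (Optimality).** For every $n\ge1$ and every such $\varepsilon$, $$\frac1{443}\,f(r_1^n)\le H(\varepsilon_1^n),$$ and $$\frac1{226816}\Big(f(r_1^n)\wedge\frac14\Big)\le L(\varepsilon)\le f(r_1^n)\wedge\frac14 .$$ -/

import Mathlib

open MeasureTheory ProbabilityTheory
open scoped ENNReal

namespace HDP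

noncomputable section

/-- The interval `[-1/2, 1/2]`: the data space of every user, and the output space of estimators. -/
abbrev Interval : Type := Set.Icc (-(1 / 2) : ℝ) (1 / 2)

/-- A randomized algorithm mapping datasets in `[-1/2, 1/2]^n` to probability distributions
on `[-1/2, 1/2]`: a Markov kernel. -/
structure Estimator (n : ℕ) where
  toKernel : Kernel (Fin n → Interval) Interval
  isMarkov : IsMarkovKernel toKernel

/-- Heterogeneous differential privacy: whenever `x` and `x'` differ at most in the entry of
user `i`, `Pr[M(x) ∈ S] ≤ exp (ε i) * Pr[M(x') ∈ S]` for all measurable `S`. -/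
def Estimator.IsDP {n : ℕ} (M : Estimator n) (ε : Fin n → ℝ) : Prop :=
  ∀ (i : Fin n) (x x' : Fin n → Interval), (∀ j, j ≠ i → x j = x' j) →
    ∀ S : Set Interval, MeasurableSet S →
      M.toKernel x S ≤ ENNReal.ofReal (Real.exp (ε i)) * M.toKernel x' S

/-- The mean `μ_P` of a distribution `P` on `[-1/2, 1/2]`. -/
def mean (P : ProbabilityMeasure Interval) : ℝ :=
  ∫ x, (x : ℝ) ∂(P : Measure Interval)

/-- The mean squared error `E[(M(X) - μ_P)^2]` for `X ∼ P^n`, over the data and the algorithm. -/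
def Estimator.mse {n : ℕ} (M : Estimator n) (P : ProbabilityMeasure Interval) : ℝ≥0∞ :=
  ∫⁻ x, ∫⁻ y, ENNReal.ofReal (((y : ℝ) - mean P) ^ 2) ∂(M.toKernel x)
    ∂(Measure.pi fun _ : Fin n => (P : Measure Interval))

/-- The worst-case error `E(M)` over all distributions on `[-1/2, 1/2]`. -/
def Estimator.worstCaseError {n : ℕ} (M : Estimator n) : ℝ≥0∞ :=
  ⨆ P : ProbabilityMeasure Interval, M.mse P

/-- The minimax error `L(ε)` over all `ε`-DP estimators. -/
def minimaxError {n : ℕ} (ε : Fin n → ℝ) : ℝ≥0∞ :=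
  ⨅ (M : Estimator n) (_ : M.IsDP ε), M.worstCaseError

/-- The norm `‖x‖₁`. -/
def l1Norm {k : ℕ} (x : Fin k → ℝ) : ℝ := ∑ i, |x i|

/-- The squared norm `‖x‖₂²`. -/
def l2NormSq {k : ℕ} (x : Fin k → ℝ) : ℝ := ∑ i, x i ^ 2

/-- `f(x) = (‖x‖₂² + 8) / (4 ‖x‖₁²)`. -/
def f {k : ℕ} (x : Fin k → ℝ) : ℝ := (l2NormSq x + 8) / (4 * l1Norm x ^ 2)

/-- The weights `r₁ = ε₁`, `r_{k+1} = min {ε_{k+1}, (‖r_1^k‖₂² + 8) / ‖r_1^k‖₁}`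
(entry `i : Fin n` is the one with number `i + 1`). -/
def weights {n : ℕ} (ε : Fin n → ℝ) (i : Fin n) : ℝ :=
  if (i : ℕ) = 0 then ε i
  else min (ε i)
    ((l2NormSq (fun j : Fin (i : ℕ) => weights ε ⟨j, j.isLt.trans i.isLt⟩) + 8) /
      l1Norm (fun j : Fin (i : ℕ) => weights ε ⟨j, j.isLt.trans i.isLt⟩))
termination_by (i : ℕ)
decreasing_by all_goals exact j.isLt

/-- `H(ε) = max_{0 ≤ i ≤ n} 1 / (‖ε_1^i‖₁² + n - i)`, where `ε_1^i` consists of the first `i`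
entries of `ε`. -/
def H {n : ℕ} (ε : Fin n → ℝ) : ℝ :=
  Finset.univ.sup' Finset.univ_nonempty fun i : Fin (n + 1) =>
    1 / (l1Norm (Fin.take (i : ℕ) i.is_le ε) ^ 2 + ((n : ℝ) - (i : ℕ)))

end

end HDP

namespace HDP

/-! Upper bound: in the average with weights `r i / l1Norm r`, sampling contributes variance at most
`‖r‖₂² / (4‖r‖₁²)`, and user `i` moves the average by at most `r i / ‖r‖₁`. Laplace noise of scale
`1 / ‖r‖₁` therefore gives user `i` privacy level `r i ≤ ε i` and adds variance `2 / ‖r‖₁²`, for a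
total of `f r` (`minimaxError_le_f`). Always answering `0` costs at most `1/4`. The cap in the
recursion for `weights` is the next weight that minimises `f` when the earlier ones are fixed; only
its algebraic consequences are used.

Lower bound: Le Cam's method with two distributions on the endpoints, of means `±δ/2`. For any `k`,
the first `k` users help to tell them apart only through their privacy levels, whose sum is `A`, and
the other `n - k` only through their data, which is worth `√(n - k)`. So `δ²` may be of order `1 /
(A² + n - k)`, and the best `k` gives `H` (`min_H_le_minimaxError`).

Comparison: the weights follow `ε` up to some index and are then constant, so `f (weights ε)` has
the closed form `1 / (4 (R² / Q + m))`, with `R` and `Q - 8` the sums of `ε` and `ε²` over the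
uncapped users and `m` the number of capped ones. This resembles a term of `H` except for the
division by `Q`. If `Q` is bounded, that is harmless. If `Q` is large, the cap forces the users with
`ε` below half of the largest uncapped level to have a small total, and cutting at that point gives
a comparable term of `H` (`f_weights_le_H`). -/

/-! ### Saturation of the weights and the closed form of `f (weights ε)` -/

theorem weights_zero {n : ℕ} (ε : Fin n → ℝ) (h : 0 < n) : weights ε ⟨0, h⟩ = ε ⟨0, h⟩ := by
  rw [weights]; simp

/-- The extension of a finite sequence by zero. -/
def extend {n : ℕ} (x : Fin n → ℝ) (j : ℕ) : ℝ := if h : j < n then x ⟨j, h⟩ else 0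

theorem extend_of_lt {n : ℕ} (x : Fin n → ℝ) {j : ℕ} (h : j < n) : extend x j = x ⟨j, h⟩ := by
  simp [extend, h]

theorem sum_fin_extend {n k : ℕ} (hk : k ≤ n) (x : Fin n → ℝ) (g : ℝ → ℝ) :
    ∑ j : Fin k, g (x ⟨j, j.isLt.trans_le hk⟩) = ∑ j ∈ Finset.range k, g (extend x j) := by
  rw [Finset.sum_range]
  exact Finset.sum_congr rfl fun j _ => by rw [extend_of_lt x (j.isLt.trans_le hk)]

theorem weights_recursion {n : ℕ} (ε : Fin n → ℝ) {k : ℕ} (h0 : k ≠ 0) (hk : k < n) :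
    extend (weights ε) k = min (extend ε k)
      ((∑ j ∈ Finset.range k, extend (weights ε) j ^ 2 + 8) /
        ∑ j ∈ Finset.range k, |extend (weights ε) j|) := by
  rw [extend_of_lt _ hk, extend_of_lt _ hk, weights]
  simp only [h0, if_false, l2NormSq, l1Norm]
  rw [sum_fin_extend hk.le (weights ε) (fun t => t ^ 2), sum_fin_extend hk.le (weights ε) (fun t => |t|)]

theorem extend_weights_pos {n : ℕ} {ε : Fin n → ℝ} (hpos : ∀ i, 0 < ε i) {k : ℕ} (hk : k < n) :
    0 < extend (weights ε) k := by
  induction k using Nat.strong_induction_on with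
  | _ k ih =>
    rcases eq_or_ne k 0 with rfl | h0
    · rw [extend_of_lt _ hk, weights_zero]; exact hpos _
    · rw [weights_recursion ε h0 hk, extend_of_lt _ hk]
      refine lt_min (hpos _) (div_pos (by positivity) ?_)
      exact Finset.sum_pos (fun j hj => abs_pos.2
        (ih j (Finset.mem_range.1 hj) ((Finset.mem_range.1 hj).trans hk)).ne')
        (Finset.nonempty_range_iff.2 h0)

theorem weights_pos {n : ℕ} {ε : Fin n → ℝ} (hpos : ∀ i, 0 < ε i) (i : Fin n) :
    0 < weights ε i := by
  have := extend_weights_pos hpos i.isLt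
  rwa [extend_of_lt] at this

theorem weights_le {n : ℕ} (ε : Fin n → ℝ) (i : Fin n) : weights ε i ≤ ε i := by
  rw [weights]; split_ifs
  · exact le_rfl
  · exact min_le_left _ _

/-- The weights agree with a monotone `ε` up to some index, and are constant from there on. -/
theorem exists_saturation_index {n : ℕ} {ε : Fin n → ℝ} (hpos : ∀ i, 0 < ε i)
    (hmono : Monotone ε) {k : ℕ} (hk0 : 0 < k) (hkn : k ≤ n) :
    ∃ i, i < k ∧ (∀ j ≤ i, extend (weights ε) j = extend ε j) ∧
      extend ε i * (∑ j ∈ Finset.range (i + 1), extend ε j) ≤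
        ∑ j ∈ Finset.range (i + 1), extend ε j ^ 2 + 8 ∧
      ∀ j, i < j → j < k → extend (weights ε) j =
        (∑ j ∈ Finset.range (i + 1), extend ε j ^ 2 + 8) /
          ∑ j ∈ Finset.range (i + 1), extend ε j := by
  have epos : ∀ j < n, 0 < extend ε j := fun j hj => by rw [extend_of_lt _ hj]; exact hpos _
  induction k with
  | zero => omega
  | succ k ih =>
    rcases Nat.eq_zero_or_pos k with rfl | hk
    · refine ⟨0, by omega, ?_, ?_, ?_⟩
      · intro j hj
        obtain rfl : j = 0 := by omega
        rw [extend_of_lt _ (by omega), extend_of_lt _ (by omega), weights_zero]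
      · simp; nlinarith
      · intros; omega
    obtain ⟨i, hik, hle, hc, hgt⟩ := ih hk (by omega)
    set Q := ∑ j ∈ Finset.range (i + 1), extend ε j ^ 2 + 8 with hQ
    set R := ∑ j ∈ Finset.range (i + 1), extend ε j with hR
    have hRpos : 0 < R := Finset.sum_pos (fun j hj => epos j
      (by have := Finset.mem_range.1 hj; omega)) (by simp)
    have hQpos : 0 < Q := by positivity
    have split : ∀ g : ℝ → ℝ, ∑ j ∈ Finset.range k, g (extend (weights ε) j) =
        ∑ j ∈ Finset.range (i + 1), g (extend ε j) + (k - (i + 1) : ℕ) * g (Q / R) := by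
      intro g
      rw [← Finset.sum_range_add_sum_Ico _ (show i + 1 ≤ k by omega)]
      congr 1
      · exact Finset.sum_congr rfl fun j hj => by
          rw [hle j (by have := Finset.mem_range.1 hj; omega)]
      · rw [Finset.sum_congr rfl (g := fun _ => g (Q / R)), Finset.sum_const, Nat.card_Ico,
          nsmul_eq_mul]
        intro j hj
        rw [Finset.mem_Ico] at hj
        rw [hgt j (by omega) (by omega)]
    have hrec := weights_recursion ε hk.ne' (show k < n by omega)
    rw [Finset.sum_congr rfl (g := fun j => extend (weights ε) j) fun j hj => abs_of_pos
      (extend_weights_pos hpos ((Finset.mem_range.1 hj).trans (by omega))),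
      split (fun t => t ^ 2), split (fun t => t)] at hrec
    -- The cap reproduces itself: each entry equal to `Q / R` adds `(Q / R) ^ 2` to the numerator
    -- and `Q / R` to the denominator, and the quotient of these is again `Q / R`.
    have hratio : (∑ j ∈ Finset.range (i + 1), extend ε j ^ 2 + (k - (i + 1) : ℕ) * (Q / R) ^ 2 + 8) /
        (R + (k - (i + 1) : ℕ) * (Q / R)) = Q / R := by
      rw [show ∑ j ∈ Finset.range (i + 1), extend ε j ^ 2 = Q - 8 by rw [hQ]; ring]
      have : 0 < R + (k - (i + 1) : ℕ) * (Q / R) := by positivity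
      rw [div_eq_iff this.ne']
      field_simp
      ring
    rw [hratio] at hrec
    -- The index moves on only if no entry has been capped yet and `ε` at `k` is still below the
    -- cap.
    by_cases hlt : i + 1 = k ∧ extend ε k < Q / R
    · obtain ⟨rfl, hlt⟩ := hlt
      refine ⟨i + 1, by omega, ?_, ?_, fun j h1 h2 => by omega⟩
      · intro j hj
        rcases Nat.lt_or_ge i j with h | h
        · obtain rfl : j = i + 1 := by omega
          rw [hrec, min_eq_left hlt.le]
        · exact hle j h
      · rw [Finset.sum_range_succ, Finset.sum_range_succ _ (i + 1), ← hR]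
        rw [lt_div_iff₀ hRpos] at hlt
        nlinarith
    · refine ⟨i, by omega, hle, hc, fun j h1 h2 => ?_⟩
      rcases Nat.lt_or_ge j k with h | h
      · exact hgt j h1 h
      obtain rfl : j = k := by omega
      rw [hrec, min_eq_right]
      -- Once an entry is capped, monotonicity of `ε` keeps all later entries at or above the cap.
      by_cases hi : i + 1 = j
      · exact not_lt.1 fun h => hlt ⟨hi, h⟩
      · have h3 := weights_le ε ⟨i + 1, by omega⟩
        have h4 := hgt (i + 1) (by omega) (by omega)
        rw [extend_of_lt _ (by omega)] at h4
        rw [h4] at h3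
        rw [extend_of_lt _ (by omega)]
        exact h3.trans (hmono (by rw [Fin.mk_le_mk]; omega))

theorem l1Norm_take {n : ℕ} {ε : Fin n → ℝ} (hpos : ∀ i, 0 < ε i) {i : ℕ} (hi : i ≤ n) :
    l1Norm (Fin.take i hi ε) = ∑ j ∈ Finset.range i, extend ε j := by
  rw [← sum_fin_extend hi ε (fun t => t)]
  exact Finset.sum_congr rfl fun j _ => abs_of_pos (hpos _)

theorem le_H {n : ℕ} {ε : Fin n → ℝ} (hpos : ∀ i, 0 < ε i) {i : ℕ} (hi : i ≤ n) :
    1 / ((∑ j ∈ Finset.range i, extend ε j) ^ 2 + ((n : ℝ) - i)) ≤ H ε := by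
  rw [← l1Norm_take hpos hi]
  exact Finset.le_sup' (f := fun i : Fin (n + 1) =>
    1 / (l1Norm (Fin.take (i : ℕ) i.is_le ε) ^ 2 + ((n : ℝ) - (i : ℕ))))
    (Finset.mem_univ (⟨i, by omega⟩ : Fin (n + 1)))

/-- With `m` capped entries, `‖r‖₂² + 8 = (Q / R) * ‖r‖₁` and `‖r‖₁ = R + m * (Q / R)`, so one
factor `‖r‖₁` cancels in `f`. The inequality on the last uncapped entry is kept for the comparison
with `H`. -/
theorem f_weights_eq {n : ℕ} (hn : 0 < n) {ε : Fin n → ℝ} (hpos : ∀ i, 0 < ε i)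
    (hmono : Monotone ε) :
    ∃ i, i < n ∧ extend ε i * (∑ j ∈ Finset.range (i + 1), extend ε j) ≤
        ∑ j ∈ Finset.range (i + 1), extend ε j ^ 2 + 8 ∧
      f (weights ε) = 1 / (4 * ((∑ j ∈ Finset.range (i + 1), extend ε j) ^ 2 /
        (∑ j ∈ Finset.range (i + 1), extend ε j ^ 2 + 8) + ((n : ℝ) - (i + 1 : ℕ)))) := by
  obtain ⟨i, hin, hle, hc, hgt⟩ := exists_saturation_index hpos hmono hn le_rfl
  refine ⟨i, hin, hc, ?_⟩
  set Q := ∑ j ∈ Finset.range (i + 1), extend ε j ^ 2 + 8 with hQ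
  set R := ∑ j ∈ Finset.range (i + 1), extend ε j with hR
  have hRpos : 0 < R := Finset.sum_pos (fun j hj => by
    rw [extend_of_lt _ (by have := Finset.mem_range.1 hj; omega)]; exact hpos _) (by simp)
  have hQpos : 0 < Q := by positivity
  have split : ∀ g : ℝ → ℝ, ∑ j ∈ Finset.range n, g (extend (weights ε) j) =
      ∑ j ∈ Finset.range (i + 1), g (extend ε j) + (n - (i + 1) : ℕ) * g (Q / R) := by
    intro g
    rw [← Finset.sum_range_add_sum_Ico _ (show i + 1 ≤ n by omega)]
    congr 1
    · exact Finset.sum_congr rfl fun j hj => by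
        rw [hle j (by have := Finset.mem_range.1 hj; omega)]
    · rw [Finset.sum_congr rfl (g := fun _ => g (Q / R)), Finset.sum_const, Nat.card_Ico,
        nsmul_eq_mul]
      intro j hj
      rw [Finset.mem_Ico] at hj
      rw [hgt j (by omega) (by omega)]
  have h1 : l1Norm (weights ε) = R + (n - (i + 1) : ℕ) * (Q / R) := by
    rw [← split (fun t => t), ← sum_fin_extend le_rfl (weights ε) (fun t => t)]
    exact Finset.sum_congr rfl fun j _ => abs_of_pos (weights_pos hpos _)
  have h2 : l2NormSq (weights ε) = (Q - 8) + (n - (i + 1) : ℕ) * (Q / R) ^ 2 := by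
    rw [hQ, add_sub_cancel_right, ← split (fun t => t ^ 2),
      ← sum_fin_extend le_rfl (weights ε) (fun t => t ^ 2)]
    rfl
  rw [f, h1, h2, ← Nat.cast_sub (by omega : i + 1 ≤ n)]
  have hm : (0 : ℝ) ≤ ((n - (i + 1) : ℕ) : ℝ) := Nat.cast_nonneg _
  generalize ((n - (i + 1) : ℕ) : ℝ) = m at hm ⊢
  have hA : 0 < R + m * (Q / R) := by positivity
  have hB : 0 < R ^ 2 / Q + m := by positivity
  rw [div_eq_div_iff (by positivity) (by positivity)]
  field_simp
  ring

/-! ### Comparison of `f (weights ε)` with `H` -/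

theorem f_weights_le_H {n : ℕ} (hn : 0 < n) {ε : Fin n → ℝ} (hpos : ∀ i, 0 < ε i)
    (hmono : Monotone ε) : 1 / 443 * f (weights ε) ≤ H ε := by
  obtain ⟨k, hkn, hc, hf⟩ := f_weights_eq hn hpos hmono
  have epos : ∀ j < n, 0 < extend ε j := fun j hj => by rw [extend_of_lt _ hj]; exact hpos _
  have emono : ∀ i j, i ≤ j → j < n → extend ε i ≤ extend ε j := fun i j hij hj => by
    rw [extend_of_lt _ hj, extend_of_lt _ (hij.trans_lt hj)]; exact hmono hij
  set V := ∑ j ∈ Finset.range (k + 1), extend ε j ^ 2 with hV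
  set E := ∑ j ∈ Finset.range (k + 1), extend ε j with hE
  set a := extend ε k with ha
  have ha0 : 0 < a := epos k hkn
  have hE0 : 0 < E := Finset.sum_pos (fun j hj => epos j
    (by have := Finset.mem_range.1 hj; omega)) (by simp)
  have hV0 : 0 ≤ V := by positivity
  have hm : (0 : ℝ) ≤ (n : ℝ) - (k + 1 : ℕ) := by
    rw [sub_nonneg]; exact_mod_cast hkn
  -- Here `1772 = 4 * 443`, the factor 4 coming from the denominator of `f`.
  have key : ∀ K : ℝ, 0 < K → K ≤ 1772 * (E ^ 2 / (V + 8) + ((n : ℝ) - (k + 1 : ℕ))) →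
      1 / 443 * f (weights ε) ≤ 1 / K := by
    intro K hK hle
    have hX : 0 < E ^ 2 / (V + 8) + ((n : ℝ) - (k + 1 : ℕ)) := by positivity
    rw [hf, div_mul_div_comm, div_le_div_iff₀ (by positivity) hK]
    linarith
  by_cases hVs : V + 8 ≤ 1772
  · refine (key _ (by positivity) ?_).trans (le_H hpos (i := k + 1) hkn)
    have : E ^ 2 / 1772 ≤ E ^ 2 / (V + 8) := by gcongr
    linarith
  · push Not at hVs
    have hVa : V ≤ a * E := by
      rw [hV, hE, Finset.mul_sum]
      refine Finset.sum_le_sum fun j hj => ?_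
      have hj := Finset.mem_range.1 hj
      nlinarith [epos j (by omega), emono j k (by omega) hkn]
    -- the first index at which `ε` reaches `a / 2`
    have hex : ∃ i, a / 2 ≤ extend ε i := ⟨k, by rw [← ha]; linarith⟩
    classical
    set i := Nat.find hex with hi
    have hik : i ≤ k := Nat.find_min' hex (by rw [← ha]; linarith)
    have hsmall : ∀ j < i, extend ε j < a / 2 := fun j hj => not_le.1 (Nat.find_min hex hj)
    have hlarge : ∀ j, i ≤ j → j < n → a / 2 ≤ extend ε j := fun j hij hj =>
      (Nat.find_spec hex).trans (emono _ _ hij hj)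
    -- Below `i`, `a - ε j` exceeds `a / 2`, while the sum of all `ε j * (a - ε j)` is `a * E - V ≤
    -- 8` by the cap condition `hc`.
    have hEi : (∑ j ∈ Finset.range i, extend ε j) * (a / 2) ≤ 8 := by
      have h1 : (∑ j ∈ Finset.range i, extend ε j) * (a / 2) ≤
          ∑ j ∈ Finset.range i, extend ε j * (a - extend ε j) := by
        rw [Finset.sum_mul]
        refine Finset.sum_le_sum fun j hj => ?_
        have hj := Finset.mem_range.1 hj
        nlinarith [epos j (by omega), hsmall j hj]
      have h2 : ∑ j ∈ Finset.range i, extend ε j * (a - extend ε j) ≤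
          ∑ j ∈ Finset.range (k + 1), extend ε j * (a - extend ε j) := by
        refine Finset.sum_le_sum_of_subset_of_nonneg (by simp; omega) fun j hj _ => ?_
        have hj := Finset.mem_range.1 hj
        exact mul_nonneg (epos j (by omega)).le (sub_nonneg.2 (emono j k (by omega) hkn))
      have h3 : ∑ j ∈ Finset.range (k + 1), extend ε j * (a - extend ε j) = a * E - V := by
        rw [hV, hE, Finset.mul_sum, ← Finset.sum_sub_distrib]
        exact Finset.sum_congr rfl fun j _ => by ring
      linarith
    have hcount : ((k : ℝ) + 1 - i) * (a / 2) ≤ E := by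
      rw [hE, ← Finset.sum_range_add_sum_Ico _ (show i ≤ k + 1 by omega)]
      have h1 : ∑ j ∈ Finset.Ico i (k + 1), a / 2 ≤ ∑ j ∈ Finset.Ico i (k + 1), extend ε j := by
        refine Finset.sum_le_sum fun j hj => ?_
        rw [Finset.mem_Ico] at hj
        exact hlarge j hj.1 (by omega)
      rw [Finset.sum_const, Nat.card_Ico, nsmul_eq_mul, Nat.cast_sub (by omega)] at h1
      have h2 : 0 ≤ ∑ j ∈ Finset.range i, extend ε j := Finset.sum_nonneg fun j hj =>
        (epos j (by have := Finset.mem_range.1 hj; omega)).le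
      push_cast at h1
      linarith
    have hin : (i : ℝ) < n := by exact_mod_cast (by omega : i < n)
    refine (key _ (by nlinarith [sq_nonneg (∑ j ∈ Finset.range i, extend ε j)]) ?_).trans
      (le_H hpos (i := i) (by omega))
    set S := ∑ j ∈ Finset.range i, extend ε j with hS
    have hS0 : 0 ≤ S := Finset.sum_nonneg fun j hj =>
        (epos j (by have := Finset.mem_range.1 hj; omega)).le
    -- From `S * a ≤ 16` follows `(S * a) ^ 2 ≤ 256`, which is below `V ≤ a * E` because `V > 1764`
    -- in this case.
    have hS2 : S ^ 2 ≤ E / a := by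
      rw [le_div_iff₀ ha0]
      have : (S * a) ^ 2 ≤ 256 := by nlinarith [mul_nonneg hS0 ha0.le]
      have : S ^ 2 * a * a ≤ E * a := by nlinarith
      exact le_of_mul_le_mul_right this ha0
    have hc2 : (k : ℝ) + 1 - i ≤ 2 * (E / a) := by
      rw [← mul_div_assoc, le_div_iff₀ ha0]; linarith
    -- Since `V ≥ 8`, `V + 8 ≤ 2 * V ≤ 2 * (a * E)`.
    have hq : E / a ≤ 2 * (E ^ 2 / (V + 8)) := by
      rw [← mul_div_assoc, div_le_div_iff₀ ha0 (by linarith)]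
      nlinarith
    have : 0 ≤ E ^ 2 / (V + 8) := by positivity
    push_cast at hm ⊢
    nlinarith

/-! ### The Laplace distribution -/

theorem integral_abs_pow_mul_exp_neg_abs (k : ℕ) :
    ∫ z : ℝ, |z| ^ k * Real.exp (-|z|) = 2 * (k.factorial : ℝ) := by
  rw [integral_comp_abs (f := fun z => z ^ k * Real.exp (-z)), ← Real.Gamma_nat_eq_factorial,
    Real.Gamma_eq_integral (by positivity)]
  congr 1
  refine setIntegral_congr_fun measurableSet_Ioi fun x _ => ?_
  simp [mul_comm]

/-- The Bochner integral of a non-integrable function is `0` by convention, whereas this one is `2 *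
k!`. -/
theorem integrable_abs_pow_mul_exp_neg_abs (k : ℕ) :
    Integrable fun z : ℝ => |z| ^ k * Real.exp (-|z|) := by
  by_contra h
  have := integral_undef h
  rw [integral_abs_pow_mul_exp_neg_abs] at this
  have := k.factorial_pos
  simp_all

theorem integral_mul_exp_neg_abs : ∫ z : ℝ, z * Real.exp (-|z|) = 0 := by
  have h := integral_neg_eq_self (fun z : ℝ => z * Real.exp (-|z|)) volume
  simp only [abs_neg, neg_mul, integral_neg] at h
  linarith

theorem integrable_mul_exp_neg_abs : Integrable fun z : ℝ => z * Real.exp (-|z|) := by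
  refine (integrable_abs_pow_mul_exp_neg_abs 1).mono'
    (by fun_prop) (Filter.Eventually.of_forall fun z => ?_)
  simp

/-- The density of the standard Laplace distribution. -/
noncomputable def laplacePDF (z : ℝ) : ℝ≥0∞ := ENNReal.ofReal (1 / 2 * Real.exp (-|z|))

theorem measurable_laplacePDF : Measurable laplacePDF := by unfold laplacePDF; fun_prop

/-- The standard Laplace distribution, of variance `2`. -/
noncomputable def laplace : Measure ℝ := volume.withDensity laplacePDF

theorem lintegral_laplace_sq (u s : ℝ) :
    ∫⁻ z, ENNReal.ofReal ((u + s * z) ^ 2) ∂laplace = ENNReal.ofReal (u ^ 2 + 2 * s ^ 2) := by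
  have hexp : ∀ z : ℝ, (u + s * z) ^ 2 * (1 / 2 * Real.exp (-|z|)) =
      u ^ 2 / 2 * (|z| ^ 0 * Real.exp (-|z|)) + u * s * (z * Real.exp (-|z|)) +
        s ^ 2 / 2 * (|z| ^ 2 * Real.exp (-|z|)) := fun z => by rw [sq_abs]; ring
  have i0 := (integrable_abs_pow_mul_exp_neg_abs 0).const_mul (u ^ 2 / 2)
  have i1 := integrable_mul_exp_neg_abs.const_mul (u * s)
  have i2 := (integrable_abs_pow_mul_exp_neg_abs 2).const_mul (s ^ 2 / 2)
  rw [laplace, lintegral_withDensity_eq_lintegral_mul _ measurable_laplacePDF (by fun_prop)]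
  calc ∫⁻ z, (laplacePDF * fun z => ENNReal.ofReal ((u + s * z) ^ 2)) z
      = ∫⁻ z, ENNReal.ofReal ((u + s * z) ^ 2 * (1 / 2 * Real.exp (-|z|))) := by
        refine lintegral_congr fun z => ?_
        rw [Pi.mul_apply, laplacePDF, mul_comm, ENNReal.ofReal_mul (sq_nonneg _)]
    _ = ENNReal.ofReal (∫ z, (u + s * z) ^ 2 * (1 / 2 * Real.exp (-|z|))) := by
        refine (ofReal_integral_eq_lintegral_ofReal ?_ ?_).symm
        · simp_rw [hexp]; exact (i0.add i1).add i2
        · exact Filter.Eventually.of_forall fun z => by simp only [Pi.zero_apply]; positivity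
    _ = _ := by
        simp_rw [hexp]
        rw [integral_add (by exact i0.add i1) i2, integral_add i0 i1, integral_const_mul,
          integral_const_mul, integral_const_mul, integral_abs_pow_mul_exp_neg_abs,
          integral_abs_pow_mul_exp_neg_abs, integral_mul_exp_neg_abs]
        congr 1
        simp [Nat.factorial]; ring

instance : IsProbabilityMeasure laplace where
  measure_univ := by simpa using lintegral_laplace_sq 1 0

/-- Shifting the centre of Laplace noise changes probabilities by a bounded factor. -/
theorem laplace_shift_le {S : Set ℝ} (hS : MeasurableSet S) (u v : ℝ) {s : ℝ} (hs : 0 < s) :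
    laplace {z | u + s * z ∈ S} ≤
      ENNReal.ofReal (Real.exp (|u - v| / s)) * laplace {z | v + s * z ∈ S} := by
  have key : ∀ w, laplace {z | w + s * z ∈ S} =
      ∫⁻ z, S.indicator 1 (w + s * z) * laplacePDF z := fun w => by
    have hm : MeasurableSet {z | w + s * z ∈ S} :=
      hS.preimage (show Measurable fun z : ℝ => w + s * z by fun_prop)
    rw [laplace, withDensity_apply _ hm, ← lintegral_indicator hm]
    refine lintegral_congr fun z => ?_
    by_cases h : w + s * z ∈ S <;> simp [h]
  -- Translating by `(v - u) / s` aligns the two events; what remains is the pointwise ratio of the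
  -- shifted densities, bounded by the triangle inequality.
  rw [key, key, ← lintegral_add_right_eq_self _ ((v - u) / s),
    ← lintegral_const_mul' _ _ ENNReal.ofReal_ne_top]
  refine lintegral_mono fun z => ?_
  rw [show u + s * (z + (v - u) / s) = v + s * z by field_simp; ring, mul_left_comm]
  gcongr
  rw [laplacePDF, laplacePDF, ← ENNReal.ofReal_mul (Real.exp_nonneg _)]
  refine ENNReal.ofReal_le_ofReal ?_
  rw [mul_left_comm, ← Real.exp_add]
  gcongr
  have h1 : |(v - u) / s| = |u - v| / s := by rw [abs_div, abs_of_pos hs, abs_sub_comm]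
  have h2 := abs_sub_abs_le_abs_sub z (-((v - u) / s))
  rw [sub_neg_eq_add, abs_neg] at h2
  have h3 := abs_sub (z + (v - u) / s) ((v - u) / s)
  rw [add_sub_cancel_right] at h3
  linarith

/-! ### The Laplace mechanism and the upper bounds -/

/-- Truncation to `[-1/2, 1/2]`. -/
noncomputable def truncate : ℝ → Interval := Set.projIcc _ _ (by norm_num)

theorem measurable_truncate : Measurable truncate := continuous_projIcc.measurable

/-- Projection onto an interval is 1-Lipschitz and fixes `m`. -/
theorem sq_truncate_sub_le (t : ℝ) {m : ℝ} (hm : m ∈ Set.Icc (-(1 / 2) : ℝ) (1 / 2)) :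
    ((truncate t : ℝ) - m) ^ 2 ≤ (t - m) ^ 2 := by
  have h := Set.abs_projIcc_sub_projIcc (a := (-(1 / 2) : ℝ)) (b := 1 / 2) (c := t) (d := m)
    (by norm_num)
  rw [Set.projIcc_of_mem _ hm] at h
  exact sq_le_sq.2 h

theorem mean_mem_Icc (P : ProbabilityMeasure Interval) :
    mean P ∈ Set.Icc (-(1 / 2) : ℝ) (1 / 2) := by
  have h := norm_integral_le_of_norm_le_const (μ := (P : Measure Interval))
    (f := fun x : Interval => (x : ℝ)) (C := 1 / 2)
    (Filter.Eventually.of_forall fun x => abs_le.2 x.2)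
  rw [probReal_univ, mul_one] at h
  exact abs_le.1 h

/-- A weighted average of i.i.d. samples estimates the mean with variance at most
`‖a‖₂² / 4`. -/
theorem lintegral_sq_weighted_sum_sub_mean {n : ℕ} (P : ProbabilityMeasure Interval)
    {a : Fin n → ℝ} (ha : ∑ i, a i = 1) {c : ℝ} (hc : 0 ≤ c) :
    ∫⁻ x : Fin n → Interval, ENNReal.ofReal ((∑ i, a i * (x i : ℝ) - mean P) ^ 2 + c)
      ∂(Measure.pi fun _ => (P : Measure Interval)) ≤
      ENNReal.ofReal (l2NormSq a / 4 + c) := by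
  set μ := Measure.pi fun _ : Fin n => (P : Measure Interval) with hμ
  have hbound : ∀ x : Interval, ‖(x : ℝ)‖ ≤ 1 / 2 := fun x => abs_le.2 x.2
  have hL : ∀ i, MemLp (fun x : Interval => a i * (x : ℝ)) 2 (P : Measure Interval) := fun i =>
    MemLp.const_mul (MemLp.of_bound (by fun_prop) (1 / 2)
      (Filter.Eventually.of_forall hbound)) (a i)
  have hvar := variance_sum_pi (μ := fun _ : Fin n => (P : Measure Interval)) hL
  have hLi : ∀ i, MemLp (fun x : Fin n → Interval => a i * (x i : ℝ)) 2 μ := fun i =>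
    (hL i).comp_measurePreserving
      (measurePreserving_eval (fun _ : Fin n => (P : Measure Interval)) i)
  have hLs : MemLp (fun x : Fin n → Interval => ∑ i, a i * (x i : ℝ)) 2 μ :=
    memLp_finsetSum _ fun i _ => hLi i
  have hmean : ∫ x : Fin n → Interval, ∑ i, a i * (x i : ℝ) ∂μ = mean P := by
    rw [integral_finsetSum _ fun i _ => (hLi i).integrable (by norm_num)]
    have : ∀ i, ∫ x : Fin n → Interval, a i * (x i : ℝ) ∂μ = a i * mean P := fun i => by
      rw [integral_const_mul, mean,
        ← (measurePreserving_eval (fun _ : Fin n => (P : Measure Interval)) i).map_eq,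
        integral_map (measurable_pi_apply i).aemeasurable (by fun_prop)]
    rw [Finset.sum_congr rfl fun i _ => this i, ← Finset.sum_mul, ha, one_mul]
  have hsq : Integrable (fun x : Fin n → Interval => (∑ i, a i * (x i : ℝ) - mean P) ^ 2) μ :=
    (hLs.sub (memLp_const _)).integrable_sq
  rw [← ofReal_integral_eq_lintegral_ofReal (by exact hsq.add (integrable_const c))
    (Filter.Eventually.of_forall fun x => add_nonneg (sq_nonneg _) hc)]
  refine ENNReal.ofReal_le_ofReal ?_
  rw [integral_add hsq (integrable_const c), integral_const, probReal_univ, one_smul]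
  gcongr
  have h1 : ∫ x : Fin n → Interval, (∑ i, a i * (x i : ℝ) - mean P) ^ 2 ∂μ =
      Var[∑ i, fun x : Fin n → Interval => a i * (x i : ℝ); μ] := by
    rw [show (∑ i, fun x : Fin n → Interval => a i * (x i : ℝ)) =
      fun x : Fin n → Interval => ∑ i, a i * (x i : ℝ) by ext; simp,
      variance_eq_integral hLs.aestronglyMeasurable.aemeasurable, hmean]
  rw [h1, hvar, l2NormSq, Finset.sum_div]
  refine Finset.sum_le_sum fun i _ => ?_
  rw [variance_const_mul]
  have := variance_le_sq_of_bounded (μ := (P : Measure Interval)) (a := -(1 / 2)) (b := 1 / 2)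
    (X := fun x : Interval => (x : ℝ)) (Filter.Eventually.of_forall fun x => x.2) (by fun_prop)
  nlinarith [sq_nonneg (a i)]

/-- The truncated Laplace mechanism around the average with weights `r / ‖r‖₁`. -/
noncomputable def laplaceMechanism {n : ℕ} (r : Fin n → ℝ) : Estimator n where
  toKernel := (Kernel.id ×ₖ Kernel.const (Fin n → Interval) laplace).map fun p =>
    truncate (∑ i, r i / l1Norm r * (p.1 i : ℝ) + 1 / l1Norm r * p.2)
  isMarkov := Kernel.IsMarkovKernel.map _ (measurable_truncate.comp (by fun_prop))

theorem lintegral_laplaceMechanism {n : ℕ} (r : Fin n → ℝ) (x : Fin n → Interval)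
    {g : Interval → ℝ≥0∞} (hg : Measurable g) :
    ∫⁻ y, g y ∂((laplaceMechanism r).toKernel x) =
      ∫⁻ z, g (truncate (∑ i, r i / l1Norm r * (x i : ℝ) + 1 / l1Norm r * z)) ∂laplace := by
  have hm : Measurable fun p : (Fin n → Interval) × ℝ =>
    truncate (∑ i, r i / l1Norm r * (p.1 i : ℝ) + 1 / l1Norm r * p.2) :=
      measurable_truncate.comp (by fun_prop)
  rw [laplaceMechanism, Kernel.lintegral_map _ hm _ hg,
    Kernel.lintegral_id_prod (by exact hg.comp hm)]
  simp

theorem laplaceMechanism_apply {n : ℕ} (r : Fin n → ℝ) (x : Fin n → Interval)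
    {S : Set Interval} (hS : MeasurableSet S) :
    (laplaceMechanism r).toKernel x S = laplace
      {z | ∑ i, r i / l1Norm r * (x i : ℝ) + 1 / l1Norm r * z ∈ truncate ⁻¹' S} := by
  have hm : MeasurableSet
      {z | ∑ i, r i / l1Norm r * (x i : ℝ) + 1 / l1Norm r * z ∈ truncate ⁻¹' S} :=
    (measurable_truncate hS).preimage
      (show Measurable fun z : ℝ => ∑ i, r i / l1Norm r * (x i : ℝ) + 1 / l1Norm r * z by fun_prop)
  rw [← lintegral_indicator_one hS, lintegral_laplaceMechanism r x
    (measurable_one.indicator hS), ← lintegral_indicator_one hm]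
  rfl

theorem l1Norm_pos {n : ℕ} (hn : 0 < n) {r : Fin n → ℝ} (hr : ∀ i, 0 < r i) : 0 < l1Norm r :=
  Finset.sum_pos (fun i _ => abs_pos.2 (hr i).ne') ⟨⟨0, hn⟩, Finset.mem_univ _⟩

/-- Changing user `i` shifts the centre by at most `r i / ‖r‖₁`, which is `r i` in units of the
noise scale `1 / ‖r‖₁`. Truncation is post-processing. -/
theorem laplaceMechanism_isDP {n : ℕ} (hn : 0 < n) {r ε : Fin n → ℝ} (hr : ∀ i, 0 < r i)
    (hrε : ∀ i, r i ≤ ε i) : (laplaceMechanism r).IsDP ε := by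
  intro i x x' hx S hS
  have hR := l1Norm_pos hn hr
  rw [laplaceMechanism_apply r x hS, laplaceMechanism_apply r x' hS]
  refine (laplace_shift_le (measurable_truncate hS) _ (∑ i, r i / l1Norm r * (x' i : ℝ))
    (one_div_pos.2 hR)).trans ?_
  gcongr
  refine le_trans ?_ (hrε i)
  have hdiff : ∑ j, r j / l1Norm r * (x j : ℝ) - ∑ j, r j / l1Norm r * (x' j : ℝ) =
      r i / l1Norm r * (x i - x' i) := by
    rw [← Finset.sum_sub_distrib, Finset.sum_eq_single i]
    · ring
    · intro j _ hj
      rw [hx j hj, sub_self]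
    · simp
  have hle : |(x i : ℝ) - x' i| ≤ 1 := by
    obtain ⟨h1, h2⟩ := (x i).2
    obtain ⟨h3, h4⟩ := (x' i).2
    rw [abs_le]
    constructor <;> linarith
  rw [hdiff, abs_mul, abs_of_pos (div_pos (hr i) hR)]
  calc r i / l1Norm r * |(x i : ℝ) - x' i| / (1 / l1Norm r)
      = r i * |(x i : ℝ) - x' i| := by field_simp
    _ ≤ r i := mul_le_of_le_one_right (hr i).le hle

theorem mse_laplaceMechanism_le {n : ℕ} (hn : 0 < n) {r : Fin n → ℝ} (hr : ∀ i, 0 < r i)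
    (P : ProbabilityMeasure Interval) : (laplaceMechanism r).mse P ≤ ENNReal.ofReal (f r) := by
  have hR := l1Norm_pos hn hr
  have hsum : ∑ i, r i / l1Norm r = 1 := by
    rw [← Finset.sum_div, div_eq_one_iff_eq hR.ne']
    exact Finset.sum_congr rfl fun i _ => (abs_of_pos (hr i)).symm
  refine le_trans (lintegral_mono fun x => ?_) ((lintegral_sq_weighted_sum_sub_mean P hsum
    (c := 2 * (1 / l1Norm r) ^ 2) (by positivity)).trans (ENNReal.ofReal_le_ofReal (le_of_eq ?_)))
  · rw [lintegral_laplaceMechanism r x (by fun_prop), ← lintegral_laplace_sq]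
    refine lintegral_mono fun z => ENNReal.ofReal_le_ofReal ?_
    refine (sq_truncate_sub_le _ (mean_mem_Icc P)).trans (le_of_eq ?_)
    ring
  · have : l2NormSq (fun i => r i / l1Norm r) = l2NormSq r / l1Norm r ^ 2 := by
      rw [l2NormSq, l2NormSq, Finset.sum_div]
      exact Finset.sum_congr rfl fun i _ => div_pow _ _ _
    rw [this, f]
    field_simp
    ring

theorem minimaxError_le_f {n : ℕ} (hn : 0 < n) {r ε : Fin n → ℝ} (hr : ∀ i, 0 < r i)
    (hrε : ∀ i, r i ≤ ε i) : minimaxError ε ≤ ENNReal.ofReal (f r) :=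
  (iInf₂_le (laplaceMechanism r) (laplaceMechanism_isDP hn hr hrε)).trans
    (iSup_le fun P => mse_laplaceMechanism_le hn hr P)

/-- The estimator that always outputs `0`. -/
noncomputable def zeroEstimator (n : ℕ) : Estimator n where
  toKernel := Kernel.const _ (Measure.dirac (⟨0, by norm_num⟩ : Interval))
  isMarkov := inferInstance

theorem minimaxError_le_quarter {n : ℕ} {ε : Fin n → ℝ} (hε : ∀ i, 0 < ε i) :
    minimaxError ε ≤ ENNReal.ofReal (1 / 4) := by
  have hDP : (zeroEstimator n).IsDP ε := fun i x x' _ S _ => by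
    rw [zeroEstimator, Kernel.const_apply, Kernel.const_apply]
    refine le_mul_of_one_le_left' ?_
    rw [← ENNReal.ofReal_one]
    exact ENNReal.ofReal_le_ofReal (Real.one_le_exp (hε i).le)
  refine (iInf₂_le (zeroEstimator n) hDP).trans (iSup_le fun P => ?_)
  obtain ⟨h1, h2⟩ := mean_mem_Icc P
  rw [Estimator.mse]
  calc _ ≤ ∫⁻ _ : Fin n → Interval, ENNReal.ofReal (1 / 4)
        ∂(Measure.pi fun _ => (P : Measure Interval)) := by
        refine lintegral_mono fun x => ?_
        rw [zeroEstimator, Kernel.const_apply, lintegral_dirac' _ (by fun_prop)]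
        exact ENNReal.ofReal_le_ofReal (by simp only; nlinarith)
    _ = _ := by simp

/-! ### Product distributions on signs -/

/-- The probability of `b` under the distribution on signs of mean `t`. -/
noncomputable def signProb (t : ℝ) (b : Bool) : ℝ := (1 + t * (if b then 1 else -1)) / 2

theorem signProb_nonneg {t : ℝ} (ht : |t| ≤ 1) (b : Bool) : 0 ≤ signProb t b := by
  have := abs_le.1 ht
  unfold signProb
  split_ifs <;> linarith

theorem signProb_true_add_false (t : ℝ) : signProb t true + signProb t false = 1 := by
  simp [signProb]; ring

/-- The probability of `x` under the product of sign distributions with means `t i`. -/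
noncomputable def signsProb {n : ℕ} (t : Fin n → ℝ) (x : Fin n → Bool) : ℝ :=
  ∏ i, signProb (t i) (x i)

theorem signsProb_nonneg {n : ℕ} {t : Fin n → ℝ} (ht : ∀ i, |t i| ≤ 1) (x : Fin n → Bool) :
    0 ≤ signsProb t x :=
  Finset.prod_nonneg fun i _ => signProb_nonneg (ht i) _

theorem sum_signsProb {n : ℕ} (t : Fin n → ℝ) : ∑ x, signsProb t x = 1 := by
  simp only [signsProb]
  rw [← Fintype.prod_sum]
  simp [signProb_true_add_false]

theorem sum_fin_succ_pi {n : ℕ} (g : (Fin (n + 1) → Bool) → ℝ) :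
    ∑ x, g x = ∑ x : Fin n → Bool, (g (Fin.cons true x) + g (Fin.cons false x)) := by
  rw [← (Fin.consEquiv fun _ : Fin (n + 1) => Bool).sum_comp, Fintype.sum_prod_type_right]
  simp [Fin.consEquiv]

theorem signsProb_cons {n : ℕ} (t : Fin (n + 1) → ℝ) (b : Bool) (x : Fin n → Bool) :
    signsProb t (Fin.cons b x) = signProb (t 0) b * signsProb (Fin.tail t) x := by
  simp [signsProb, Fin.prod_univ_succ, Fin.tail]

/-- Changing the means of the signs changes the expectation of a function in proportion to its
sensitivities. -/
theorem sum_signsProb_sub_le_sensitivity {n : ℕ} {s t : Fin n → ℝ} (hs : ∀ i, |s i| ≤ 1)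
    (ht : ∀ i, |t i| ≤ 1) (hst : ∀ i, t i ≤ s i) {g : (Fin n → Bool) → ℝ} {D : Fin n → ℝ}
    (hg : ∀ i, t i ≠ s i → ∀ x y, (∀ j, j ≠ i → x j = y j) → g x - g y ≤ D i) :
    ∑ x, signsProb s x * g x - ∑ x, signsProb t x * g x ≤ ∑ i, (s i - t i) / 2 * D i := by
  induction n with
  | zero => simp [signsProb]
  | succ n ih =>
    have hsb : ∀ b, ∑ x, signsProb (Fin.tail s) x * g (Fin.cons b x) -
        ∑ x, signsProb (Fin.tail t) x * g (Fin.cons b x) ≤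
          ∑ i, (Fin.tail s i - Fin.tail t i) / 2 * Fin.tail D i := fun b =>
      ih (fun i => hs i.succ) (fun i => ht i.succ) (fun i => hst i.succ) fun i hi x y hxy =>
        hg i.succ hi _ _ fun j hj => by
          refine Fin.cases (fun _ => rfl) (fun k hk => ?_) j hj
          rw [Fin.cons_succ, Fin.cons_succ]
          exact hxy k fun h => hk (h ▸ rfl)
    -- The head mean is changed while the tail has means `t`; the tail change `hsb` is then averaged
    -- over the head with mean `s 0`, so the two contributions add exactly.
    have h0 : (s 0 - t 0) / 2 * (∑ x, signsProb (Fin.tail t) x * g (Fin.cons true x) -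
        ∑ x, signsProb (Fin.tail t) x * g (Fin.cons false x)) ≤ (s 0 - t 0) / 2 * D 0 := by
      by_cases h : t 0 = s 0
      · simp [h]
      refine mul_le_mul_of_nonneg_left ?_ (by linarith [hst 0])
      rw [← Finset.sum_sub_distrib]
      calc ∑ x, (signsProb (Fin.tail t) x * g (Fin.cons true x) -
            signsProb (Fin.tail t) x * g (Fin.cons false x))
          ≤ ∑ x, signsProb (Fin.tail t) x * D 0 := Finset.sum_le_sum fun x _ => by
            rw [← mul_sub]
            refine mul_le_mul_of_nonneg_left (hg 0 h _ _ fun j hj => ?_)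
              (signsProb_nonneg (fun i => ht i.succ) x)
            obtain ⟨k, rfl⟩ := Fin.exists_succ_eq.2 hj
            simp
        _ = D 0 := by rw [← Finset.sum_mul, sum_signsProb, one_mul]
    have expand : ∀ r : Fin (n + 1) → ℝ, ∑ x, signsProb r x * g x =
        signProb (r 0) true * ∑ x, signsProb (Fin.tail r) x * g (Fin.cons true x) +
        signProb (r 0) false * ∑ x, signsProb (Fin.tail r) x * g (Fin.cons false x) := by
      intro r
      rw [sum_fin_succ_pi, Finset.sum_add_distrib, Finset.mul_sum, Finset.mul_sum]
      simp only [signsProb_cons, mul_assoc]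
    rw [expand s, expand t, Fin.sum_univ_succ]
    change _ ≤ (s 0 - t 0) / 2 * D 0 + ∑ i, (Fin.tail s i - Fin.tail t i) / 2 * Fin.tail D i
    have h1 := mul_le_mul_of_nonneg_left (hsb true) (signProb_nonneg (hs 0) true)
    have h2 := mul_le_mul_of_nonneg_left (hsb false) (signProb_nonneg (hs 0) false)
    have h3 := signProb_true_add_false (s 0)
    generalize ∑ i, (Fin.tail s i - Fin.tail t i) / 2 * Fin.tail D i = Z at *
    have h4 : signProb (s 0) true * Z + signProb (s 0) false * Z = Z := by
      rw [← add_mul, h3, one_mul]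
    refine le_trans (le_of_eq ?_) (add_le_add h0 ((add_le_add h1 h2).trans_eq h4))
    simp only [signProb]
    simp
    ring

/-- The total variation distance is bounded in terms of the Bhattacharyya coefficient. -/
theorem sq_sum_abs_sub_le {ι : Type*} [Fintype ι] {p q : ι → ℝ} (hp : ∀ i, 0 ≤ p i)
    (hq : ∀ i, 0 ≤ q i) (hp1 : ∑ i, p i = 1) (hq1 : ∑ i, q i = 1) :
    (∑ i, |p i - q i|) ^ 2 ≤ 4 * (1 - (∑ i, √(p i * q i)) ^ 2) := by
  -- Cauchy–Schwarz is applied to this factorisation; the two sums of squares are `2 - 2 * BC` and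
  -- `2 + 2 * BC`, with `BC` the Bhattacharyya coefficient.
  have h1 : ∀ i, |p i - q i| = |√(p i) - √(q i)| * (√(p i) + √(q i)) := fun i => by
    rw [← abs_of_nonneg (add_nonneg (Real.sqrt_nonneg (p i)) (Real.sqrt_nonneg (q i))), ← abs_mul]
    congr 1
    nlinarith [Real.sq_sqrt (hp i), Real.sq_sqrt (hq i)]
  have h2 : ∑ i, |√(p i) - √(q i)| ^ 2 = 2 - 2 * ∑ i, √(p i * q i) := by
    trans ∑ i, p i + ∑ i, q i - 2 * ∑ i, √(p i * q i)
    on_goal 2 => rw [hp1, hq1]; norm_num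
    rw [← Finset.sum_add_distrib, Finset.mul_sum, ← Finset.sum_sub_distrib]
    refine Finset.sum_congr rfl fun i _ => ?_
    rw [sq_abs, Real.sqrt_mul (hp i)]
    nlinarith [Real.sq_sqrt (hp i), Real.sq_sqrt (hq i)]
  have h3 : ∑ i, (√(p i) + √(q i)) ^ 2 = 2 + 2 * ∑ i, √(p i * q i) := by
    trans ∑ i, p i + ∑ i, q i + 2 * ∑ i, √(p i * q i)
    on_goal 2 => rw [hp1, hq1]; norm_num
    rw [← Finset.sum_add_distrib, Finset.mul_sum, ← Finset.sum_add_distrib]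
    refine Finset.sum_congr rfl fun i _ => ?_
    rw [Real.sqrt_mul (hp i)]
    nlinarith [Real.sq_sqrt (hp i), Real.sq_sqrt (hq i)]
  simp_rw [h1]
  refine (Finset.sum_mul_sq_le_sq_mul_sq _ _ _).trans (le_of_eq ?_)
  rw [h2, h3]
  ring

theorem sum_sqrt_signProb_self {t : ℝ} (ht : |t| ≤ 1) :
    ∑ b, √(signProb t b * signProb t b) = 1 := by
  simp [Real.sqrt_mul_self (signProb_nonneg ht _), signProb_true_add_false]

theorem sum_sqrt_signProb_neg (t : ℝ) :
    ∑ b, √(signProb t b * signProb (-t) b) = √(1 - t ^ 2) := by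
  have h : ∀ b, signProb t b * signProb (-t) b = (1 - t ^ 2) * (1 / 2) ^ 2 := fun b => by
    cases b <;> simp [signProb] <;> ring
  simp_rw [h]
  rw [Real.sqrt_mul' _ (by positivity), Real.sqrt_sq (by norm_num)]
  simp
  ring

/-- The total variation distance between products of signs that differ in at most `m` factors. -/
theorem sum_abs_signsProb_sub_le {n m : ℕ} {δ : ℝ} (hδ0 : 0 ≤ δ) (hδ1 : δ ≤ 1)
    {s t : Fin n → ℝ} (hs : ∀ i, |s i| ≤ 1) (J : Finset (Fin n)) (hJ : J.card = m)
    (hst : ∀ i, i ∉ J → t i = s i) (hsJ : ∀ i ∈ J, s i = δ ∧ t i = -δ) :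
    ∑ x, |signsProb s x - signsProb t x| ≤ 2 * δ * √m := by
  have ht : ∀ i, |t i| ≤ 1 := fun i => by
    by_cases h : i ∈ J
    · rw [(hsJ i h).2, abs_neg, ← (hsJ i h).1]; exact hs i
    · rw [hst i h]; exact hs i
  have hBC : ∑ x, √(signsProb s x * signsProb t x) = √(1 - δ ^ 2) ^ m := by
    have h1 : ∀ x, √(signsProb s x * signsProb t x) =
        ∏ i, √(signProb (s i) (x i) * signProb (t i) (x i)) := fun x => by
      rw [signsProb, signsProb, ← Finset.prod_mul_distrib, Real.sqrt_prod]
      exact fun i _ => mul_nonneg (signProb_nonneg (hs i) _) (signProb_nonneg (ht i) _)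
    simp_rw [h1]
    rw [← Fintype.prod_sum fun i b => √(signProb (s i) b * signProb (t i) b),
      ← Finset.prod_subset (Finset.subset_univ J), ← hJ, ← Finset.prod_const]
    · refine Finset.prod_congr rfl fun i hi => ?_
      rw [(hsJ i hi).1, (hsJ i hi).2, sum_sqrt_signProb_neg]
    · intro i _ hi
      rw [hst i hi, sum_sqrt_signProb_self (hs i)]
  have h2 := sq_sum_abs_sub_le (signsProb_nonneg hs) (signsProb_nonneg ht) (sum_signsProb s)
    (sum_signsProb t)
  have hδ2 : 0 ≤ 1 - δ ^ 2 := by nlinarith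
  rw [hBC, ← pow_mul, mul_comm m 2, pow_mul, Real.sq_sqrt hδ2] at h2
  -- Bernoulli: the squared coefficient `(1 - δ ^ 2) ^ m` is at least `1 - m * δ ^ 2`.
  have h3 := one_add_mul_le_pow (a := -δ ^ 2) (by nlinarith) m
  rw [← sub_eq_add_neg] at h3
  refine abs_le_of_sq_le_sq' ?_ (by positivity) |>.2
  rw [mul_pow, mul_pow, Real.sq_sqrt (Nat.cast_nonneg m)]
  linarith

/-- How well a bounded function of signs, insensitive to the first `k` of them, distinguishes
between the means `δ` and `-δ`. -/
theorem sum_signsProb_const_sub_le {n k : ℕ} (hk : k ≤ n) {δ B : ℝ} (hδ0 : 0 ≤ δ) (hδ1 : δ ≤ 1)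
    {g : (Fin n → Bool) → ℝ} (hB : ∀ x, |g x| ≤ B) {ε : Fin n → ℝ}
    (hg : ∀ i, ∀ x y, (∀ j, j ≠ i → x j = y j) → g x - g y ≤ 2 * B * ε i) :
    ∑ x, signsProb (fun _ => δ) x * g x - ∑ x, signsProb (fun _ => -δ) x * g x ≤
      2 * B * δ * (∑ i : Fin k, ε (Fin.castLE hk i) + √(n - k : ℕ)) := by
  have hδa : |δ| ≤ 1 := by rwa [abs_of_nonneg hδ0]
  have hδa' : |-δ| ≤ 1 := by rwa [abs_neg]
  have hB0 : 0 ≤ B := (abs_nonneg _).trans (hB fun _ => true)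
  -- A hybrid between the two products: passing from `δ` to `t` is charged to sensitivity, and from
  -- `t` to `-δ` to total variation.
  set t : Fin n → ℝ := fun i => if (i : ℕ) < k then -δ else δ with ht
  have ht1 : ∀ i, |t i| ≤ 1 := fun i => by simp only [ht]; split_ifs <;> assumption
  have h1 : ∑ x, signsProb (fun _ => δ) x * g x - ∑ x, signsProb t x * g x ≤
      2 * B * δ * ∑ i : Fin k, ε (Fin.castLE hk i) := by
    refine (sum_signsProb_sub_le_sensitivity (fun _ => hδa) ht1
      (fun i => by simp only [ht]; split_ifs <;> linarith) fun i _ => hg i).trans (le_of_eq ?_)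
    obtain ⟨m, rfl⟩ := Nat.exists_eq_add_of_le hk
    rw [Fin.sum_univ_add, Finset.mul_sum]
    simp only [ht, Fin.val_castAdd, Fin.is_lt, if_true, Fin.val_natAdd]
    rw [Finset.sum_eq_zero (s := Finset.univ (α := Fin m)) (fun i _ => by simp), add_zero]
    refine Finset.sum_congr rfl fun i _ => ?_
    rw [show Fin.castLE hk i = Fin.castAdd m i from rfl]
    ring
  have h2 : ∑ x, signsProb t x * g x - ∑ x, signsProb (fun _ => -δ) x * g x ≤
      2 * B * δ * √(n - k : ℕ) := by
    have h3 := sum_abs_signsProb_sub_le (m := n - k) hδ0 hδ1 ht1 (t := fun _ => -δ)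
      (Finset.univ.filter fun i : Fin n => ¬ (i : ℕ) < k)
      (by rw [Finset.filter_not, Finset.card_sdiff_of_subset (by simp), Finset.card_univ,
            Fintype.card_fin, Fin.card_filter_val_lt, min_eq_right hk])
      (fun i hi => by simp at hi; simp [ht, hi])
      (fun i hi => by simp at hi; simp [ht, hi])
    rw [← Finset.sum_sub_distrib]
    calc ∑ x, (signsProb t x * g x - signsProb (fun _ => -δ) x * g x)
        ≤ ∑ x, |signsProb t x - signsProb (fun _ => -δ) x| * B := Finset.sum_le_sum fun x _ => by
          rw [← sub_mul]
          refine (le_abs_self _).trans ?_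
          rw [abs_mul]
          exact mul_le_mul_of_nonneg_left (hB x) (abs_nonneg _)
      _ ≤ 2 * δ * √(n - k : ℕ) * B := by
          rw [← Finset.sum_mul]; exact mul_le_mul_of_nonneg_right h3 hB0
      _ = _ := by ring
  linarith

/-! ### Le Cam's method and the lower bound -/

/-- The distribution on `Bool` given by `signProb`. -/
noncomputable def signMeasure (t : ℝ) : Measure Bool :=
  ENNReal.ofReal (signProb t true) • Measure.dirac true +
    ENNReal.ofReal (signProb t false) • Measure.dirac false

theorem signMeasure_singleton (t : ℝ) (b : Bool) :
    signMeasure t {b} = ENNReal.ofReal (signProb t b) := by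
  cases b <;> simp [signMeasure]

theorem isProbabilityMeasure_signMeasure {t : ℝ} (ht : |t| ≤ 1) :
    IsProbabilityMeasure (signMeasure t) where
  measure_univ := by
    simp only [signMeasure, Measure.add_apply, Measure.smul_apply, measure_univ, smul_eq_mul,
      mul_one]
    rw [← ENNReal.ofReal_add (signProb_nonneg ht _) (signProb_nonneg ht _),
      signProb_true_add_false, ENNReal.ofReal_one]

/-- The endpoints of `[-1/2, 1/2]`. -/
noncomputable def endpoint (b : Bool) : Interval :=
  if b then ⟨1 / 2, by norm_num⟩ else ⟨-(1 / 2), by norm_num⟩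

theorem measurable_endpoint : Measurable endpoint := measurable_of_countable _

/-- The distribution on the endpoints of `[-1/2, 1/2]` with mean `t / 2`. -/
noncomputable def endpointMeasure {t : ℝ} (ht : |t| ≤ 1) : ProbabilityMeasure Interval :=
  ⟨(signMeasure t).map endpoint,
    have := isProbabilityMeasure_signMeasure ht
    Measure.isProbabilityMeasure_map measurable_endpoint.aemeasurable⟩

theorem mean_endpointMeasure {t : ℝ} (ht : |t| ≤ 1) : mean (endpointMeasure ht) = t / 2 := by
  have := isProbabilityMeasure_signMeasure ht
  have h : ∫ b, (endpoint b : ℝ) ∂(signMeasure t) = t / 2 := by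
    rw [integral_fintype .of_finite]
    simp only [measureReal_def, signMeasure_singleton, Fintype.univ_bool, smul_eq_mul,
      ENNReal.toReal_ofReal (signProb_nonneg ht _)]
    simp [endpoint, signProb]
    ring
  rw [← h]
  exact integral_map measurable_endpoint.aemeasurable (by fun_prop)

theorem lintegral_pi_endpointMeasure {n : ℕ} {t : ℝ} (ht : |t| ≤ 1)
    {g : (Fin n → Interval) → ℝ≥0∞} (hg : Measurable g) :
    ∫⁻ x, g x ∂(Measure.pi fun _ : Fin n => (endpointMeasure ht : Measure Interval)) =
      ∑ x : Fin n → Bool, ENNReal.ofReal (signsProb (fun _ => t) x) * g fun i => endpoint (x i) := by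
  have := isProbabilityMeasure_signMeasure ht
  have := Measure.isProbabilityMeasure_map (μ := signMeasure t) measurable_endpoint.aemeasurable
  change ∫⁻ x, g x ∂(Measure.pi fun _ : Fin n => (signMeasure t).map endpoint) = _
  rw [← Measure.pi_map_pi fun _ => measurable_endpoint.aemeasurable,
    lintegral_map hg (measurable_of_countable _), lintegral_fintype]
  refine Finset.sum_congr rfl fun x _ => ?_
  rw [Measure.pi_singleton, mul_comm, signsProb,
    ENNReal.ofReal_prod_of_nonneg fun i _ => signProb_nonneg ht _]
  simp only [signMeasure_singleton]

/-- Replacing `y` by `T y` only reduces the distance to `m`, and the square of a mean is at most the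
mean square because variance is nonnegative. -/
theorem lintegral_sq_sub_ge {ν : Measure Interval} [IsProbabilityMeasure ν] {T : Interval → ℝ}
    (hT : Measurable T) {B m : ℝ} (hB : ∀ y, |T y| ≤ B)
    (hm : ∀ y : Interval, |T y - m| ≤ |(y : ℝ) - m|) :
    ENNReal.ofReal ((∫ y, T y ∂ν - m) ^ 2) ≤ ∫⁻ y, ENNReal.ofReal (((y : ℝ) - m) ^ 2) ∂ν := by
  have hL : MemLp T 2 ν := MemLp.of_bound hT.aestronglyMeasurable B (.of_forall hB)
  have hLm : MemLp (fun y => T y - m) 2 ν := hL.sub (memLp_const m)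
  have hv := variance_eq_sub hLm
  have hmean : ∫ y, (T y - m) ∂ν = ∫ y, T y ∂ν - m := by
    rw [integral_sub (hL.integrable (by norm_num)) (integrable_const m)]; simp
  rw [hmean] at hv
  have hle : (∫ y, T y ∂ν - m) ^ 2 ≤ ∫ y, (T y - m) ^ 2 ∂ν := by
    have := variance_nonneg (fun y => T y - m) ν
    rw [hv] at this
    exact sub_nonneg.1 this
  refine (ENNReal.ofReal_le_ofReal hle).trans ?_
  rw [ofReal_integral_eq_lintegral_ofReal hLm.integrable_sq (.of_forall fun y => sq_nonneg _)]
  exact lintegral_mono fun y => ENNReal.ofReal_le_ofReal (sq_le_sq.2 (hm y))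

/-- The shift `T + B` is nonnegative, so the comparison of measures applies to it. Using `1 - e ≤
exp (-e)` on the side of `ν` gives a bound linear in `e` for every `e ≥ 0`, where `exp e - 1` would
not. -/
theorem integral_sub_le_of_measure_le {ν ν' : Measure Interval} [IsProbabilityMeasure ν]
    [IsProbabilityMeasure ν'] {e : ℝ} (he : 0 ≤ e) (hν : ν ≤ ENNReal.ofReal (Real.exp e) • ν')
    {T : Interval → ℝ} (hT : Measurable T) {B : ℝ} (hB : ∀ y, |T y| ≤ B) :
    ∫ y, T y ∂ν - ∫ y, T y ∂ν' ≤ 2 * B * e := by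
  have hi : ∀ ρ : Measure Interval, [IsProbabilityMeasure ρ] → Integrable T ρ := fun ρ _ =>
    Integrable.of_bound hT.aestronglyMeasurable B (.of_forall hB)
  have hadd : ∀ ρ : Measure Interval, [IsProbabilityMeasure ρ] →
      ∫ y, (T y + B) ∂ρ = ∫ y, T y ∂ρ + B := fun ρ _ => by
    rw [integral_add (hi ρ) (integrable_const B)]; simp
  have h0 : ∀ y, 0 ≤ T y + B := fun y => by linarith [(abs_le.1 (hB y)).1]
  have hmono : ∫ y, (T y + B) ∂ν ≤ Real.exp e * ∫ y, (T y + B) ∂ν' := by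
    have := integral_mono_measure (f := fun y => T y + B) hν (.of_forall h0)
      (((hi ν').add (integrable_const B)).smul_measure ENNReal.ofReal_ne_top)
    rwa [integral_smul_measure, ENNReal.toReal_ofReal (Real.exp_nonneg _), smul_eq_mul] at this
  have hub : ∫ y, T y ∂ν ≤ B := by
    have := integral_mono (hi ν) (integrable_const B) fun y => (le_abs_self _).trans (hB y)
    simpa using this
  have hlb : 0 ≤ ∫ y, (T y + B) ∂ν := integral_nonneg h0
  rw [hadd, hadd] at hmono
  rw [hadd] at hlb
  have hexp : (1 - e) * (∫ y, T y ∂ν + B) ≤ ∫ y, T y ∂ν' + B := by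
    calc (1 - e) * (∫ y, T y ∂ν + B) ≤ Real.exp (-e) * (∫ y, T y ∂ν + B) := by
          gcongr; linarith [Real.add_one_le_exp (-e)]
      _ ≤ Real.exp (-e) * (Real.exp e * (∫ y, T y ∂ν' + B)) := by gcongr
      _ = _ := by rw [← mul_assoc, ← Real.exp_add]; simp
  nlinarith [mul_nonneg he (sub_nonneg.2 hub)]

theorem mse_endpointMeasure_ge {n : ℕ} (M : Estimator n) {t : ℝ} (ht : |t| ≤ 1)
    {T : Interval → ℝ} (hT : Measurable T) {B : ℝ} (hB : ∀ y, |T y| ≤ B)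
    (hm : ∀ y : Interval, |T y - t / 2| ≤ |(y : ℝ) - t / 2|) :
    ENNReal.ofReal ((∑ x : Fin n → Bool, signsProb (fun _ => t) x *
      ∫ y, T y ∂(M.toKernel fun i => endpoint (x i)) - t / 2) ^ 2) ≤
        M.mse (endpointMeasure ht) := by
  have := M.isMarkov
  have hp := signsProb_nonneg (n := n) fun _ => ht
  rw [Estimator.mse, mean_endpointMeasure, lintegral_pi_endpointMeasure ht (Measurable.lintegral_kernel (by fun_prop))]
  set h : (Fin n → Bool) → ℝ := fun x => ∫ y, T y ∂(M.toKernel fun i => endpoint (x i)) with hh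
  calc ENNReal.ofReal ((∑ x, signsProb (fun _ => t) x * h x - t / 2) ^ 2)
      ≤ ENNReal.ofReal (∑ x, signsProb (fun _ => t) x * (h x - t / 2) ^ 2) := by
        refine ENNReal.ofReal_le_ofReal ?_
        have := (even_two.convexOn_pow (𝕜 := ℝ)).map_sum_le (t := Finset.univ)
          (w := signsProb fun _ : Fin n => t) (p := fun x => h x - t / 2) (fun x _ => hp x)
          (sum_signsProb _) (fun _ _ => Set.mem_univ _)
        simp only [smul_eq_mul, mul_sub, Finset.sum_sub_distrib, ← Finset.sum_mul, sum_signsProb,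
          one_mul] at this
        exact this
    _ = ∑ x, ENNReal.ofReal (signsProb (fun _ => t) x) * ENNReal.ofReal ((h x - t / 2) ^ 2) := by
        rw [ENNReal.ofReal_sum_of_nonneg fun x _ => mul_nonneg (hp x) (sq_nonneg _)]
        exact Finset.sum_congr rfl fun x _ => ENNReal.ofReal_mul (hp x)
    _ ≤ _ := by
        gcongr with x
        exact lintegral_sq_sub_ge hT hB hm

/-- Le Cam's two-point method, with the first `k` users bounded by privacy and the others by
the information in their data. -/
theorem sq_le_worstCaseError {n k : ℕ} (hk : k ≤ n) {ε : Fin n → ℝ} (hε : ∀ i, 0 ≤ ε i) {M : Estimator n}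
    (hM : M.IsDP ε) {δ : ℝ} (hδ0 : 0 ≤ δ) (hδ1 : δ ≤ 1)
    (hδ : δ * (∑ i : Fin k, ε (Fin.castLE hk i) + √(n - k : ℕ)) ≤ 1 / 2) :
    ENNReal.ofReal (δ ^ 2 / 16) ≤ M.worstCaseError := by
  have := M.isMarkov
  have hδa : |δ| ≤ 1 := by rwa [abs_of_nonneg hδ0]
  have hδa' : |-δ| ≤ 1 := by rwa [abs_neg]
  have hI : -(δ / 2) ≤ δ / 2 := by linarith
  -- Outputs are clipped to the range between the two candidate means. This brings no output farther
  -- from either mean and makes the bound `B = δ / 2` proportional to `δ`.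
  set T : Interval → ℝ := fun y => (Set.projIcc _ _ hI (y : ℝ) : ℝ) with hT
  have hTm : Measurable T :=
    (continuous_subtype_val.comp (continuous_projIcc.comp continuous_subtype_val)).measurable
  have hTB : ∀ y, |T y| ≤ δ / 2 := fun y => abs_le.2 (Set.projIcc _ _ hI (y : ℝ)).2
  have hTc : ∀ m ∈ Set.Icc (-(δ / 2)) (δ / 2), ∀ y : Interval, |T y - m| ≤ |(y : ℝ) - m| :=
    fun m hm y => by
      have := Set.abs_projIcc_sub_projIcc (c := (y : ℝ)) (d := m) hI
      rwa [Set.projIcc_of_mem _ hm] at this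
  set h : (Fin n → Bool) → ℝ := fun x => ∫ y, T y ∂(M.toKernel fun i => endpoint (x i)) with hh
  have hhB : ∀ x, |h x| ≤ δ / 2 := fun x => by
    have := norm_integral_le_of_norm_le_const (μ := M.toKernel fun i => endpoint (x i))
      (f := T) (.of_forall hTB)
    rwa [probReal_univ, mul_one] at this
  have hsens := sum_signsProb_const_sub_le hk hδ0 hδ1 hhB (ε := ε) fun i x y hxy =>
    integral_sub_le_of_measure_le (hε i) (Measure.le_iff.2 fun S hS =>
      hM i _ _ (fun j hj => by rw [hxy j hj]) S hS) hTm hTB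
  have h1 := mse_endpointMeasure_ge M hδa hTm hTB (hTc _ ⟨by linarith, le_rfl⟩)
  have h2 := mse_endpointMeasure_ge M hδa' hTm hTB (hTc _ ⟨by linarith, by linarith⟩)
  -- The means are `δ` apart, but by `hsens` and `hδ` the expected clipped outputs differ by at most
  -- `δ / 2`, so one of them is off by at least `δ / 4`.
  have hgap : δ / 4 ≤ δ / 2 - ∑ x, signsProb (fun _ => δ) x * h x ∨
      δ / 4 ≤ ∑ x, signsProb (fun _ => -δ) x * h x + δ / 2 := by
    by_contra! hcon
    nlinarith
  rcases hgap with hgap | hgap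
  · refine le_trans (ENNReal.ofReal_le_ofReal ?_) (h1.trans (le_iSup (fun P => M.mse P) _))
    nlinarith
  · refine le_trans (ENNReal.ofReal_le_ofReal ?_) (h2.trans (le_iSup (fun P => M.mse P) _))
    nlinarith

theorem le_minimaxError {n k : ℕ} (hk : k ≤ n) {ε : Fin n → ℝ} (hε : ∀ i, 0 ≤ ε i)
    (hK : 0 < (∑ i : Fin k, ε (Fin.castLE hk i)) ^ 2 + ((n : ℝ) - k)) :
    ENNReal.ofReal (1 / 128 * min (1 / ((∑ i : Fin k, ε (Fin.castLE hk i)) ^ 2 + ((n : ℝ) - k))) 8)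
      ≤ minimaxError ε := by
  refine le_iInf₂ fun M hM => ?_
  rw [← Nat.cast_sub hk] at *
  set A := ∑ i : Fin k, ε (Fin.castLE hk i) with hA
  set K := A ^ 2 + ((n - k : ℕ) : ℝ) with hKdef
  -- The choice gives `δ² (A + √(n - k))² ≤ 2 δ² K ≤ 1/4`; the minimum with `1` keeps `±δ`
  -- admissible as sign means.
  set δ := √(min (1 / (8 * K)) 1) with hδ
  have hδ2 : δ ^ 2 = min (1 / (8 * K)) 1 := Real.sq_sqrt (by positivity)
  have hδ0 : 0 ≤ δ := Real.sqrt_nonneg _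
  have hδ1 : δ ≤ 1 := Real.sqrt_le_one.2 (min_le_right _ _)
  have h := sq_le_worstCaseError hk hε hM hδ0 hδ1 ?_
  · refine le_trans (ENNReal.ofReal_le_ofReal ?_) h
    rw [hδ2, mul_min_of_nonneg _ _ (by norm_num), ← min_div_div_right (by norm_num)]
    refine le_of_eq ?_
    congr 1
    · field_simp; norm_num
    · norm_num
  · have hm := Real.sq_sqrt (Nat.cast_nonneg (α := ℝ) (n - k))
    have h1 : δ ^ 2 * (8 * K) ≤ 1 := by
      rw [hδ2, ← le_div_iff₀ (by positivity)]; exact min_le_left _ _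
    refine abs_le_of_sq_le_sq' ?_ (by norm_num) |>.2
    rw [← hA]
    rw [hKdef, ← hm] at h1
    nlinarith [mul_nonneg (sq_nonneg δ) (sq_nonneg (A - √(n - k : ℕ)))]

theorem min_H_le_minimaxError {n : ℕ} (hn : 0 < n) {ε : Fin n → ℝ} (hpos : ∀ i, 0 < ε i) :
    ENNReal.ofReal (1 / 128 * min (H ε) 8) ≤ minimaxError ε := by
  obtain ⟨i, -, hi⟩ := Finset.exists_mem_eq_sup' Finset.univ_nonempty fun i : Fin (n + 1) =>
    1 / (l1Norm (Fin.take (i : ℕ) i.is_le ε) ^ 2 + ((n : ℝ) - (i : ℕ)))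
  have hl : l1Norm (Fin.take (i : ℕ) i.is_le ε) = ∑ j : Fin i, ε (Fin.castLE i.is_le j) :=
    Finset.sum_congr rfl fun j _ => abs_of_pos (hpos _)
  rw [H, hi, hl]
  refine le_minimaxError i.is_le (fun j => (hpos j).le) ?_
  rcases i.is_le.lt_or_eq with h | h
  · have : ((i : ℕ) : ℝ) < n := by exact_mod_cast h
    have := sq_nonneg (∑ j : Fin i, ε (Fin.castLE i.is_le j))
    linarith
  · have : 0 < ∑ j : Fin i, ε (Fin.castLE i.is_le j) :=
      Finset.sum_pos (fun j _ => hpos _) ⟨⟨0, by omega⟩, Finset.mem_univ _⟩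
    have hcast : ((i : ℕ) : ℝ) = n := by exact_mod_cast h
    rw [hcast, sub_self, add_zero]
    positivity

end HDP

theorem theorem4 (n : ℕ) (hn : 0 < n) (ε : Fin n → ℝ) (hpos : ∀ i, 0 < ε i)
    (hmono : Monotone ε) :
    1 / 443 * HDP.f (HDP.weights ε) ≤ HDP.H ε ∧
      ENNReal.ofReal (1 / 226816 * min (HDP.f (HDP.weights ε)) (1 / 4)) ≤ HDP.minimaxError ε ∧
      HDP.minimaxError ε ≤ ENNReal.ofReal (min (HDP.f (HDP.weights ε)) (1 / 4)) := by
  have hH := HDP.f_weights_le_H hn hpos hmono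
  refine ⟨hH, le_trans (ENNReal.ofReal_le_ofReal ?_) (HDP.min_H_le_minimaxError hn hpos), ?_⟩
  · have h1 := min_le_left (HDP.f (HDP.weights ε)) (1 / 4)
    have h2 := min_le_right (HDP.f (HDP.weights ε)) (1 / 4)
    have h0 : 0 ≤ HDP.f (HDP.weights ε) := by
      unfold HDP.f HDP.l2NormSq
      positivity
    -- Here `226816 = 4 * 128 * 443`, so chaining the two bounds leaves a factor of 4 to spare.
    rw [mul_min_of_nonneg _ _ (by norm_num : (0 : ℝ) ≤ 1 / 128), le_min_iff]
    constructor <;> linarith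
  · rw [ENNReal.ofReal_min, le_min_iff]
    exact ⟨HDP.minimaxError_le_f hn (HDP.weights_pos hpos) (HDP.weights_le ε),
      HDP.minimaxError_le_quarter hpos⟩
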